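/- For real $a,b,c$ with $c\ne 0,-1,-2,\dots$ let $F(a,b;c;z)=\sum_{n\ge 0}\frac{(a)_n(b)_n}{(c)_n}\frac{z^n}{n!}$, $|z|<1$, be the Gaussian hypergeometric function, where $(a)_0=1$ and $(a)_n=a(a+1)\cdots(a+n-1)$. For $z\in(0,1)$ put $u(z)=F(a-1,b;c;z)$, $v(z)=F(a,b;c;z)$, $u_1(z)=u(1-z)$, $v_1(z)=v(1-z)$. Let $a,b>0$, $c\ge 1$ and $2c=a+b+1$. Then a constant $A$ satisfies $$(c-a)(uv_1+u_1v)+(a-1)vv_1=A\,z^{1-c}(1-z)^{1-c}\qquad\text{for all } z\in(0,1)$$ if and only if $$A=\frac{\Gamma(c)^2}{\Gamma(a)\Gamma(b)};$$ in particular, the identity holds with this value of $A$. If moreover $c=1$ (so that $0<a<1$ and $b=1-a$), the identity reduces to Legendre's relation for generalized elliptic integrals. Namely, for $r\in(0,1)$ and $r'=\sqrt{1-r^2}$ let $$\mathcal K_a(r)=\tfrac{\pi}{2}F(a,1-a;1;r^2),\quad \mathcal E_a(r)=\tfrac{\pi}{2}F(a-1,1-a;1;r^2),\quad \mathcal K_a'(r)=\mathcal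 K_a(r'),\quad \mathcal E_a'(r)=\mathcal E_a(r').$$ Then, for every $r\in(0,1)$, the left side of the identity at $z=r^2$ equals $(1-a)\left(\tfrac{2}{\pi}\right)^2\left(\mathcal E_a\mathcal K_a'+\mathcal E_a'\mathcal K_a-\mathcal K_a\mathcal K_a'\right)(r)$, and $$\mathcal E_a\mathcal K_a'+\mathcal E_a'\mathcal K_a-\mathcal K_a\mathcal K_a'=\frac{\pi\sin(\pi a)}{4(1-a)}.$$ -/

import Mathlib

noncomputable section

/-- `u(z) = F(a-1, b; c; z)`, where `F` is the Gaussian hypergeometric function. -/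
def hypU (a b c z : ℝ) : ℝ := ordinaryHypergeometric (a - 1) b c z

/-- `v(z) = F(a, b; c; z)`. -/
def hypV (a b c z : ℝ) : ℝ := ordinaryHypergeometric a b c z

/-- The expression `(c-a)(u v₁ + u₁ v) + (a-1) v v₁` at `z`, where `u₁(z) = u(1-z)` and
`v₁(z) = v(1-z)`. -/
def legendreForm (a b c z : ℝ) : ℝ :=
  (c - a) * (hypU a b c z * hypV a b c (1 - z) + hypU a b c (1 - z) * hypV a b c z)
    + (a - 1) * (hypV a b c z * hypV a b c (1 - z))

/-- The generalized elliptic integral of the first kind, `K_a(r) = (π/2) F(a, 1-a; 1; r²)`. -/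
def genEllipticK (a r : ℝ) : ℝ :=
  Real.pi / 2 * ordinaryHypergeometric a (1 - a) (1 : ℝ) (r ^ 2)

/-- The generalized elliptic integral of the second kind, `E_a(r) = (π/2) F(a-1, 1-a; 1; r²)`. -/
def genEllipticE (a r : ℝ) : ℝ :=
  Real.pi / 2 * ordinaryHypergeometric (a - 1) (1 - a) (1 : ℝ) (r ^ 2)

/-- `E_a K_a' + E_a' K_a - K_a K_a'` at `r`, where `K_a'(r) = K_a(r')`, `E_a'(r) = E_a(r')` and
`r' = √(1 - r²)`. -/
def genLegendre (a r : ℝ) : ℝ :=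
  genEllipticE a r * genEllipticK a (Real.sqrt (1 - r ^ 2))
    + genEllipticE a (Real.sqrt (1 - r ^ 2)) * genEllipticK a r
    - genEllipticK a r * genEllipticK a (Real.sqrt (1 - r ^ 2))

end

/-
Write `v₁' = v'(1 - z)`. The contiguous relations `z u' = (a - 1) (v - u)` and
`z (1 - z) v' = (c - a) u + (a - c + b z) v` form a first order system for `(u, v)`, and when
`2 c = a + b + 1` they show that `L = (c - a) (u v₁ + u₁ v) + (a - 1) v v₁` satisfies
`z (1 - z) L' = (1 - c) (1 - 2 z) L`. Hence `z ^ (c - 1) (1 - z) ^ (c - 1) L` is constant. They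
also give `L = z (1 - z) (v v₁' + v' v₁)`, so for `c > 0` the constant can be read off as `z → 0`,
where `z ^ c v₁ → 0` and `z ^ c v₁' → Γ(c)² / (Γ(a) Γ(b))` by comparing power series coefficients
with those of `(1 - x) ^ (-c)`. The remaining `c` follow by shifting `(a, b, c)` to
`(a + 1, b + 1, c + 1)`, since `F'` is a multiple of the shifted `F`.
-/

open Asymptotics Filter Polynomial Set Topology

section Coefficients

variable {R : Type*} [CommRing R]

lemma ascPochhammer_succ_eval_left (n : ℕ) (s : R) :
    (ascPochhammer R (n + 1)).eval s = s * (ascPochhammer R n).eval (s + 1) := by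
  simp [ascPochhammer_succ_left, eval_comp]

lemma mul_ascPochhammer_eval_add_one (n : ℕ) (s : R) :
    s * (ascPochhammer R n).eval (s + 1) = (ascPochhammer R n).eval s * (s + n) := by
  rw [← ascPochhammer_succ_eval_left, ascPochhammer_succ_eval]

variable {𝕂 : Type*} [Field 𝕂]

local notation "coeff₂F₁" => ordinaryHypergeometricCoefficient

lemma ordinaryHypergeometricCoefficient_zero (a b c : 𝕂) : coeff₂F₁ a b c 0 = 1 := by
  simp [ordinaryHypergeometricCoefficient]

lemma ordinaryHypergeometricCoefficient_add_one_left (a b c : 𝕂) (n : ℕ) :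
    a * coeff₂F₁ (a + 1) b c n = (a + n) * coeff₂F₁ a b c n := by
  rw [ordinaryHypergeometricCoefficient, ordinaryHypergeometricCoefficient]
  linear_combination ((n.factorial : 𝕂)⁻¹ * (ascPochhammer 𝕂 n).eval b *
    ((ascPochhammer 𝕂 n).eval c)⁻¹) * mul_ascPochhammer_eval_add_one n a

lemma ordinaryHypergeometricCoefficient_add_one_right (a b c : 𝕂) {n : ℕ} (hn : c + n ≠ 0) :
    b / c * (c + n) * coeff₂F₁ a (b + 1) (c + 1) n = (b + n) * coeff₂F₁ a b c n := by
  have hc : c⁻¹ * ((ascPochhammer 𝕂 n).eval (c + 1))⁻¹ * (c + n)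
      = ((ascPochhammer 𝕂 n).eval c)⁻¹ := by
    rw [← mul_inv, mul_ascPochhammer_eval_add_one, mul_inv, inv_mul_cancel_right₀ hn]
  rw [ordinaryHypergeometricCoefficient, ordinaryHypergeometricCoefficient, ← hc]
  linear_combination ((n.factorial : 𝕂)⁻¹ * (ascPochhammer 𝕂 n).eval a * c⁻¹ *
    ((ascPochhammer 𝕂 n).eval (c + 1))⁻¹ * (c + n)) * mul_ascPochhammer_eval_add_one n b

variable [CharZero 𝕂]

lemma ordinaryHypergeometricCoefficient_succ_eq_add_one (a b c : 𝕂) (n : ℕ) :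
    (n + 1) * coeff₂F₁ a b c (n + 1) = a * b / c * coeff₂F₁ (a + 1) (b + 1) (c + 1) n := by
  have : (n + 1 : 𝕂) ≠ 0 := n.cast_add_one_ne_zero
  simp only [ordinaryHypergeometricCoefficient, ascPochhammer_succ_eval_left, Nat.factorial_succ,
    Nat.cast_mul, Nat.cast_add_one, mul_inv]
  field_simp

lemma ordinaryHypergeometricCoefficient_succ_eq_add_one_left (a b c : 𝕂) {n : ℕ}
    (hn : c + n ≠ 0) :
    (n + 1) * (c + n) * coeff₂F₁ a b c (n + 1) = a * (b + n) * coeff₂F₁ (a + 1) b c n := by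
  linear_combination (c + n) * ordinaryHypergeometricCoefficient_succ_eq_add_one a b c n
    + a * ordinaryHypergeometricCoefficient_add_one_right (a + 1) b c hn

lemma ordinaryHypergeometricCoefficient_succ (a b c : 𝕂) {n : ℕ} (hn : c + n ≠ 0) :
    (n + 1) * (c + n) * coeff₂F₁ a b c (n + 1) = (a + n) * (b + n) * coeff₂F₁ a b c n := by
  linear_combination ordinaryHypergeometricCoefficient_succ_eq_add_one_left a b c hn
    + (b + n) * ordinaryHypergeometricCoefficient_add_one_left a b c n

lemma ordinaryHypergeometricCoefficient_contiguous (a b c : 𝕂) {n : ℕ} (hn : c + n ≠ 0) :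
    (n + 1 + (c - a)) * coeff₂F₁ a b c (n + 1) - (c - a) * coeff₂F₁ (a - 1) b c (n + 1)
      = (n + b) * coeff₂F₁ a b c n := by
  have h := ordinaryHypergeometricCoefficient_succ a b c hn
  have h' := ordinaryHypergeometricCoefficient_succ_eq_add_one_left (a - 1) b c hn
  rw [sub_add_cancel] at h'
  refine mul_left_cancel₀ (mul_ne_zero n.cast_add_one_ne_zero hn) ?_
  linear_combination (n + 1 + (c - a)) * h - (c - a) * h'

end Coefficients

section PowerSeries

lemma hasSum_mul_pow_of_succ {R : Type*} [CommRing R] [TopologicalSpace R] [IsTopologicalRing R]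
    {s : ℕ → R} {x S : R} (h : HasSum (fun n ↦ s (n + 1) * x ^ n) S) :
    HasSum (fun n ↦ s n * x ^ n) (s 0 + x * S) := by
  rw [← hasSum_nat_add_iff' 1]
  simpa [pow_succ', mul_left_comm] using h.mul_left x

lemma hasSum_deriv_powerSeries {𝕜 E : Type*} [NontriviallyNormedField 𝕜] [NormedAddCommGroup E]
    [NormedSpace 𝕜 E] [CompleteSpace E] (p : FormalMultilinearSeries 𝕜 𝕜 E) {x : 𝕜}
    (hx : ‖x‖ₑ < p.radius) :
    HasSum (fun n ↦ x ^ n • (n + 1) • p.coeff (n + 1)) (deriv p.sum x) := by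
  have h := (p.derivSeries.hasSum (x := x)
    (by simpa using hx.trans_le p.radius_le_radius_derivSeries)).mapL
      (ContinuousLinearMap.apply 𝕜 E (1 : 𝕜))
  rw [(p.hasFDerivAt_sum hx).hasDerivAt.deriv]
  simpa only [FormalMultilinearSeries.apply_eq_pow_smul_coeff, ContinuousLinearMap.apply_apply,
    smul_apply, FormalMultilinearSeries.derivSeries_coeff_one] using! h

end PowerSeries

section Hypergeometric

variable {𝕂 : Type*} [RCLike 𝕂] (a b c : 𝕂) {x : 𝕂}

lemma one_le_radius_ordinaryHypergeometricSeries (𝔸 : Type*) [NormedDivisionRing 𝔸]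
    [NormedAlgebra 𝕂 𝔸] : 1 ≤ (ordinaryHypergeometricSeries 𝔸 a b c).radius := by
  by_cases! h : ∀ k : ℕ, (k : 𝕂) ≠ -a ∧ (k : 𝕂) ≠ -b ∧ (k : 𝕂) ≠ -c
  · exact (ordinaryHypergeometricSeries_radius_eq_one 𝔸 a b c h).ge
  · obtain ⟨k, hk⟩ := h
    obtain h | h | h : (k : 𝕂) = -a ∨ (k : 𝕂) = -b ∨ (k : 𝕂) = -c := by tauto
    all_goals obtain rfl := neg_eq_iff_eq_neg.2 h
    · simp [ordinaryHypergeometric_radius_top_of_neg_nat₁]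
    · simp [ordinaryHypergeometric_radius_top_of_neg_nat₂]
    · simp [ordinaryHypergeometric_radius_top_of_neg_nat₃]

lemma enorm_lt_radius_ordinaryHypergeometricSeries (hx : ‖x‖ < 1) :
    ‖x‖ₑ < (ordinaryHypergeometricSeries 𝕂 a b c).radius :=
  (by simpa [← ofReal_norm] using hx : ‖x‖ₑ < 1).trans_le
    (one_le_radius_ordinaryHypergeometricSeries a b c 𝕂)

lemma hasSum_ordinaryHypergeometric (hx : ‖x‖ < 1) :
    HasSum (fun n ↦ ordinaryHypergeometricCoefficient a b c n * x ^ n) (₂F₁ a b c x) := by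
  simpa only [ordinaryHypergeometricSeries_apply_eq, smul_eq_mul] using!
    (ordinaryHypergeometricSeries 𝕂 a b c).hasSum (x := x)
      (by simpa using enorm_lt_radius_ordinaryHypergeometricSeries a b c hx)

lemma analyticAt_ordinaryHypergeometric (hx : ‖x‖ < 1) : AnalyticAt 𝕂 (₂F₁ a b c) x :=
  have hr := enorm_lt_radius_ordinaryHypergeometricSeries a b c hx
  ((ordinaryHypergeometricSeries 𝕂 a b c).hasFPowerSeriesOnBall
    (pos_of_gt hr)).analyticAt_of_mem (by simpa using hr)

lemma hasDerivAt_ordinaryHypergeometric (hx : ‖x‖ < 1) :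
    HasDerivAt (₂F₁ a b c) (deriv (₂F₁ a b c) x) x :=
  (analyticAt_ordinaryHypergeometric a b c hx).differentiableAt.hasDerivAt

lemma hasSum_deriv_ordinaryHypergeometric (hx : ‖x‖ < 1) :
    HasSum (fun n ↦ (n + 1) * ordinaryHypergeometricCoefficient a b c (n + 1) * x ^ n)
      (deriv (₂F₁ a b c) x) := by
  refine (hasSum_deriv_powerSeries (ordinaryHypergeometricSeries 𝕂 a b c)
    (enorm_lt_radius_ordinaryHypergeometricSeries a b c hx)).congr_fun fun n ↦ ?_
  rw [ordinaryHypergeometricSeries, FormalMultilinearSeries.coeff_ofScalars, nsmul_eq_mul,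
    Nat.cast_add_one, smul_eq_mul, mul_comm]

lemma hasSum_mul_deriv_ordinaryHypergeometric (hx : ‖x‖ < 1) :
    HasSum (fun n ↦ n * ordinaryHypergeometricCoefficient a b c n * x ^ n)
      (x * deriv (₂F₁ a b c) x) := by
  simpa using hasSum_mul_pow_of_succ (s := fun n ↦ n * ordinaryHypergeometricCoefficient a b c n)
    (by simpa using hasSum_deriv_ordinaryHypergeometric a b c hx)

lemma deriv_ordinaryHypergeometric (hx : ‖x‖ < 1) :
    deriv (₂F₁ a b c) x = a * b / c * ₂F₁ (a + 1) (b + 1) (c + 1) x := by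
  refine (hasSum_deriv_ordinaryHypergeometric a b c hx).unique <|
    ((hasSum_ordinaryHypergeometric (a + 1) (b + 1) (c + 1) hx).mul_left (a * b / c)).congr_fun
      fun n ↦ ?_
  rw [ordinaryHypergeometricCoefficient_succ_eq_add_one, mul_assoc]

lemma mul_deriv_ordinaryHypergeometric (hx : ‖x‖ < 1) :
    x * deriv (₂F₁ a b c) x = a * (₂F₁ (a + 1) b c x - ₂F₁ a b c x) := by
  refine (hasSum_mul_deriv_ordinaryHypergeometric a b c hx).unique <|
    (((hasSum_ordinaryHypergeometric (a + 1) b c hx).sub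
      (hasSum_ordinaryHypergeometric a b c hx)).mul_left a).congr_fun fun n ↦ ?_
  linear_combination -x ^ n * ordinaryHypergeometricCoefficient_add_one_left a b c n

variable {c} (hc : ∀ k : ℕ, c ≠ -k)
include hc

lemma one_sub_mul_deriv_ordinaryHypergeometric (hx : ‖x‖ < 1) :
    (1 - x) * deriv (₂F₁ a b c) x
      = b * ₂F₁ a b c x - b / c * (c - a) * ₂F₁ a (b + 1) (c + 1) x := by
  have hF := hasSum_ordinaryHypergeometric a b c hx
  have hG := hasSum_ordinaryHypergeometric a (b + 1) (c + 1) hx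
  rw [one_sub_mul]
  refine ((hasSum_deriv_ordinaryHypergeometric a b c hx).sub
    (hasSum_mul_deriv_ordinaryHypergeometric a b c hx)).unique <|
    ((hF.mul_left b).sub (hG.mul_left (b / c * (c - a)))).congr_fun fun n ↦ ?_
  have hn : c + n ≠ 0 := fun h ↦ hc n (eq_neg_of_add_eq_zero_left h)
  refine mul_left_cancel₀ hn ?_
  linear_combination x ^ n * (ordinaryHypergeometricCoefficient_succ a b c hn
    + (c - a) * ordinaryHypergeometricCoefficient_add_one_right a b c hn)

lemma mul_one_sub_mul_deriv_ordinaryHypergeometric (hx : ‖x‖ < 1) :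
    x * (1 - x) * deriv (₂F₁ a b c) x
      = (c - a) * ₂F₁ (a - 1) b c x + (a - c + b * x) * ₂F₁ a b c x := by
  have hF := hasSum_ordinaryHypergeometric a b c hx
  have hD := hasSum_mul_deriv_ordinaryHypergeometric a b c hx
  have hU := hasSum_ordinaryHypergeometric (a - 1) b c hx
  have hS := hasSum_mul_pow_of_succ (x := x)
    (s := fun n ↦ (n + (c - a)) * ordinaryHypergeometricCoefficient a b c n
      - (c - a) * ordinaryHypergeometricCoefficient (a - 1) b c n)
    ((hD.add (hF.mul_left b)).congr_fun fun n ↦ by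
      have hn : c + n ≠ 0 := fun h ↦ hc n (eq_neg_of_add_eq_zero_left h)
      push_cast
      rw [ordinaryHypergeometricCoefficient_contiguous a b c hn]
      ring)
  have h := ((hD.add (hF.mul_left (c - a))).sub (hU.mul_left (c - a))).unique <|
    hS.congr_fun fun n ↦ by ring
  simp only [ordinaryHypergeometricCoefficient_zero, Nat.cast_zero] at h
  linear_combination h

end Hypergeometric

section BoundaryBehaviour

variable {q : ℕ → ℝ} {Q : ℝ → ℝ}

lemma isLittleO_hasSum_pow {E : Type*} [NormedAddCommGroup E] [NormedSpace ℝ E] {p : ℕ → E}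
    {P : ℝ → E} (hq : ∀ n, 0 ≤ q n) (hpq : p =o[atTop] q)
    (hP : ∀ x ∈ Ioo (0 : ℝ) 1, HasSum (fun n ↦ x ^ n • p n) (P x))
    (hQ : ∀ x ∈ Ioo (0 : ℝ) 1, HasSum (fun n ↦ q n * x ^ n) (Q x))
    (hQtop : Tendsto Q (𝓝[<] 1) atTop) : P =o[𝓝[<] 1] Q := by
  refine isLittleO_iff.2 fun ε hε ↦ ?_
  obtain ⟨N, hN⟩ := eventually_atTop.1 (hpq.bound (half_pos hε))
  let head : ℕ → ℝ := fun n ↦ if n ∈ Finset.range N then ‖p n‖ else 0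
  have hhead : HasSum head (∑ n ∈ Finset.range N, head n) :=
    hasSum_sum_of_ne_finset_zero fun n hn ↦ if_neg hn
  filter_upwards [Ioo_mem_nhdsLT one_pos, hQtop.eventually_ge_atTop 0,
    hQtop.eventually_ge_atTop ((∑ n ∈ Finset.range N, head n) / (ε / 2))] with x hx hQx hQM
  have hterm (n : ℕ) : ‖x ^ n • p n‖ ≤ head n + ε / 2 * (q n * x ^ n) := by
    have hxn : 0 ≤ x ^ n := pow_nonneg hx.1.le n
    rw [norm_smul, Real.norm_of_nonneg hxn]
    by_cases hn : n < N
    · have hqx : 0 ≤ ε / 2 * (q n * x ^ n) := by have := hq n; positivity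
      simpa [head, hn] using (mul_le_of_le_one_left (norm_nonneg _)
        (pow_le_one₀ hx.1.le hx.2.le)).trans (le_add_of_nonneg_right hqx)
    · have hpn := hN n (not_lt.1 hn)
      rw [Real.norm_of_nonneg (hq n)] at hpn
      calc x ^ n * ‖p n‖ ≤ x ^ n * (ε / 2 * q n) := mul_le_mul_of_nonneg_left hpn hxn
        _ = head n + ε / 2 * (q n * x ^ n) := by
          simp only [head, Finset.mem_range, hn, if_false]
          ring
  have hbound := (hP x hx).norm_le_of_bounded (hhead.add ((hQ x hx).mul_left (ε / 2))) hterm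
  rw [div_le_iff₀ (half_pos hε)] at hQM
  rw [Real.norm_of_nonneg hQx]
  linarith

lemma tendsto_div_of_hasSum_pow {p : ℕ → ℝ} {P : ℝ → ℝ} {l : ℝ} (hq : ∀ n, 0 < q n)
    (hpq : Tendsto (fun n ↦ p n / q n) atTop (𝓝 l))
    (hP : ∀ x ∈ Ioo (0 : ℝ) 1, HasSum (fun n ↦ p n * x ^ n) (P x))
    (hQ : ∀ x ∈ Ioo (0 : ℝ) 1, HasSum (fun n ↦ q n * x ^ n) (Q x))
    (hQtop : Tendsto Q (𝓝[<] 1) atTop) : Tendsto (fun x ↦ P x / Q x) (𝓝[<] 1) (𝓝 l) := by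
  have hcoeff : (fun n ↦ p n - l * q n) =o[atTop] q := by
    refine isLittleO_of_tendsto (fun n h ↦ absurd h (hq n).ne') ?_
    rw [← sub_self l]
    exact (hpq.sub_const l).congr fun n ↦ div_sub' (hq n).ne' |>.trans (by ring)
  have hsum : (fun x ↦ P x - l * Q x) =o[𝓝[<] 1] Q :=
    isLittleO_hasSum_pow (fun n ↦ (hq n).le) hcoeff
      (fun x hx ↦ ((hP x hx).sub ((hQ x hx).mul_left l)).congr_fun fun n ↦ by
        rw [smul_eq_mul]; ring) hQ hQtop
  have h := hsum.tendsto_div_nhds_zero.add_const l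
  rw [zero_add] at h
  refine h.congr' ?_
  filter_upwards [hQtop.eventually_gt_atTop 0] with x hx
  field_simp
  ring

lemma hasSum_one_sub_rpow_neg (c : ℝ) {x : ℝ} (hx : |x| < 1) :
    HasSum (fun n ↦ (ascPochhammer ℝ n).eval c / n.factorial * x ^ n) ((1 - x) ^ (-c)) := by
  have h := (Real.one_div_one_sub_rpow_hasFPowerSeriesOnBall_zero c).hasSum (y := x)
    (by simpa [← ofReal_norm] using hx)
  rw [zero_add, one_div, ← Real.rpow_neg (by linarith [(abs_lt.1 hx).2])] at h
  refine h.congr_fun fun n ↦ ?_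
  have hchoose := Ring.factorial_nsmul_multichoose_eq_ascPochhammer c n
  rw [ascPochhammer_smeval_cast, ascPochhammer_smeval_eq_eval, nsmul_eq_mul] at hchoose
  rw [FormalMultilinearSeries.ofScalars_apply_eq, smul_eq_mul, ← Ring.multichoose_eq, ← hchoose,
    mul_div_cancel_left₀ _ (by positivity)]

lemma tendsto_one_sub_rpow_neg_atTop {d : ℝ} (hd : 0 < d) :
    Tendsto (fun x : ℝ ↦ (1 - x) ^ (-d)) (𝓝[<] 1) atTop := by
  have h : Tendsto (fun x : ℝ ↦ 1 - x) (𝓝[<] 1) (𝓝[>] (1 - 1)) :=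
    ContinuousWithinAt.tendsto_nhdsWithin (by fun_prop) fun x hx ↦ by simpa using hx
  rw [sub_self] at h
  exact (tendsto_rpow_neg_nhdsGT_zero (neg_lt_zero.2 hd)).comp h

lemma tendsto_one_sub_rpow_mul_ordinaryHypergeometric {a b c d l : ℝ} (hd : 0 < d)
    (hl : Tendsto (fun n ↦ (ascPochhammer ℝ n).eval a * (ascPochhammer ℝ n).eval b /
      ((ascPochhammer ℝ n).eval c * (ascPochhammer ℝ n).eval d)) atTop (𝓝 l)) :
    Tendsto (fun x : ℝ ↦ (1 - x) ^ d * ₂F₁ a b c x) (𝓝[<] 1) (𝓝 l) := by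
  have habs (x : ℝ) (hx : x ∈ Ioo (0 : ℝ) 1) : |x| < 1 := (abs_of_pos hx.1).trans_lt hx.2
  have hcoeff : Tendsto (fun n ↦ ordinaryHypergeometricCoefficient a b c n /
      ((ascPochhammer ℝ n).eval d / n.factorial)) atTop (𝓝 l) := by
    refine hl.congr fun n ↦ ?_
    rw [ordinaryHypergeometricCoefficient]
    field_simp
  refine (tendsto_div_of_hasSum_pow
    (fun n ↦ div_pos (ascPochhammer_pos n d hd) (by positivity)) hcoeff
    (fun x hx ↦ hasSum_ordinaryHypergeometric a b c (habs x hx))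
    (fun x hx ↦ hasSum_one_sub_rpow_neg d (habs x hx))
    (tendsto_one_sub_rpow_neg_atTop hd)).congr' ?_
  filter_upwards [self_mem_nhdsWithin] with x hx
  rw [Real.rpow_neg (sub_nonneg.2 (le_of_lt hx)), div_inv_eq_mul, mul_comm]

lemma GammaSeq_eq_div_ascPochhammer (s : ℝ) (n : ℕ) :
    Real.GammaSeq s n = n ^ s * n.factorial / (ascPochhammer ℝ (n + 1)).eval s := by
  rw [Real.GammaSeq]
  congr 1
  induction n + 1 with
  | zero => simp
  | succ k ih => rw [Finset.prod_range_succ, ih, ascPochhammer_succ_eval]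

lemma ne_neg_natCast_of_pos {s : ℝ} (hs : 0 < s) (k : ℕ) : s ≠ -k :=
  ((neg_nonpos.2 k.cast_nonneg).trans_lt hs).ne'

lemma add_one_ne_neg_natCast {s : ℝ} (hs : ∀ k : ℕ, s ≠ -k) (k : ℕ) : s + 1 ≠ -k :=
  fun h ↦ hs (k + 1) <| by push_cast; linarith

variable {a b : ℝ} (ha : ∀ k : ℕ, a ≠ -k) (hb : ∀ k : ℕ, b ≠ -k)
include ha hb

-- If `c` or `d` is a pole of `Γ`, both sides are `0`: the quotient eventually has denominator `0`,
-- and `Real.Gamma` is `0` at its poles.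
lemma tendsto_rpow_mul_ascPochhammer_div (c d : ℝ) :
    Tendsto (fun n : ℕ ↦ (n : ℝ) ^ (c + d - (a + b)) *
        ((ascPochhammer ℝ (n + 1)).eval a * (ascPochhammer ℝ (n + 1)).eval b /
          ((ascPochhammer ℝ (n + 1)).eval c * (ascPochhammer ℝ (n + 1)).eval d)))
      atTop (𝓝 (Real.Gamma c * Real.Gamma d / (Real.Gamma a * Real.Gamma b))) := by
  refine (((Real.GammaSeq_tendsto_Gamma c).mul (Real.GammaSeq_tendsto_Gamma d)).div
    ((Real.GammaSeq_tendsto_Gamma a).mul (Real.GammaSeq_tendsto_Gamma b))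
    (mul_ne_zero (Real.Gamma_ne_zero ha) (Real.Gamma_ne_zero hb))).congr' ?_
  filter_upwards [eventually_gt_atTop 0] with n hn
  have hn' : (0 : ℝ) < n := Nat.cast_pos.2 hn
  have hfac : (n.factorial : ℝ) ≠ 0 := by positivity
  simp only [Pi.div_apply, GammaSeq_eq_div_ascPochhammer, Real.rpow_sub hn', Real.rpow_add hn']
  field_simp

lemma tendsto_one_sub_rpow_mul_ordinaryHypergeometric_of_lt {c : ℝ} (hc : c < a + b) :
    Tendsto (fun x : ℝ ↦ (1 - x) ^ (a + b - c) * ₂F₁ a b c x) (𝓝[<] 1)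
      (𝓝 (Real.Gamma c * Real.Gamma (a + b - c) / (Real.Gamma a * Real.Gamma b))) :=
  tendsto_one_sub_rpow_mul_ordinaryHypergeometric (sub_pos.2 hc) <|
    (tendsto_add_atTop_iff_nat 1).1 <| by
      simpa using tendsto_rpow_mul_ascPochhammer_div ha hb c (a + b - c)

lemma tendsto_one_sub_rpow_mul_ordinaryHypergeometric_zero {c d : ℝ} (hd : 0 < d)
    (h : a + b < c + d) :
    Tendsto (fun x : ℝ ↦ (1 - x) ^ d * ₂F₁ a b c x) (𝓝[<] 1) (𝓝 0) := by
  refine tendsto_one_sub_rpow_mul_ordinaryHypergeometric hd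
    ((tendsto_add_atTop_iff_nat 1).1 ?_)
  have hlim := ((tendsto_rpow_neg_atTop (sub_pos.2 h)).comp tendsto_natCast_atTop_atTop).mul
    (tendsto_rpow_mul_ascPochhammer_div ha hb c d)
  rw [zero_mul] at hlim
  refine hlim.congr' ?_
  filter_upwards [eventually_gt_atTop 0] with n hn
  have hn' : (0 : ℝ) < n := Nat.cast_pos.2 hn
  rw [Function.comp_apply, Real.rpow_neg hn'.le, inv_mul_cancel_left₀ (by positivity)]

lemma tendsto_one_sub_rpow_mul_deriv_ordinaryHypergeometric {c : ℝ} (hc : c ≠ 0)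
    (h : c < a + b + 1) :
    Tendsto (fun x : ℝ ↦ (1 - x) ^ (a + b + 1 - c) * deriv (₂F₁ a b c) x) (𝓝[<] 1)
      (𝓝 (Real.Gamma c * Real.Gamma (a + b + 1 - c) / (Real.Gamma a * Real.Gamma b))) := by
  have ha₀ : a ≠ 0 := by simpa using ha 0
  have hb₀ : b ≠ 0 := by simpa using hb 0
  have hlim := (tendsto_one_sub_rpow_mul_ordinaryHypergeometric_of_lt
    (add_one_ne_neg_natCast ha) (add_one_ne_neg_natCast hb)
    (by linarith : c + 1 < a + 1 + (b + 1))).const_mul (a * b / c)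
  rw [show a + 1 + (b + 1) - (c + 1) = a + b + 1 - c by ring, Real.Gamma_add_one ha₀,
    Real.Gamma_add_one hb₀, Real.Gamma_add_one hc] at hlim
  refine (hlim.congr' ?_).trans_eq ?_
  · filter_upwards [Ioo_mem_nhdsLT one_pos] with x hx
    rw [deriv_ordinaryHypergeometric a b c ((abs_of_pos hx.1).trans_lt hx.2), mul_left_comm]
  · congr 1
    field_simp

end BoundaryBehaviour

section LegendreForm

lemma abs_lt_one_and_abs_one_sub_lt_one {z : ℝ} (hz : z ∈ Ioo (0 : ℝ) 1) :
    |z| < 1 ∧ |1 - z| < 1 := by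
  obtain ⟨h0, h1⟩ := hz
  constructor <;> rw [abs_lt] <;> constructor <;> linarith

variable {a b c : ℝ}

section FirstOrderSystem

variable (hc : ∀ k : ℕ, c ≠ -k) (habc : 2 * c = a + b + 1)
include hc habc

lemma legendreForm_eq_mul_deriv {z : ℝ} (hz : z ∈ Ioo (0 : ℝ) 1) :
    legendreForm a b c z
      = z * (1 - z) * (deriv (₂F₁ a b c) z * ₂F₁ a b c (1 - z)
        + ₂F₁ a b c z * deriv (₂F₁ a b c) (1 - z)) := by
  obtain ⟨hz₀, hz₁⟩ := abs_lt_one_and_abs_one_sub_lt_one hz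
  have h₀ := mul_one_sub_mul_deriv_ordinaryHypergeometric a b hc hz₀
  have h₁ := mul_one_sub_mul_deriv_ordinaryHypergeometric a b hc hz₁
  simp only [legendreForm, hypU, hypV]
  linear_combination -(₂F₁ a b c (1 - z)) * h₀ - ₂F₁ a b c z * h₁
    + ₂F₁ a b c z * ₂F₁ a b c (1 - z) * habc

lemma hasDerivAt_legendreForm {z : ℝ} (hz : z ∈ Ioo (0 : ℝ) 1) :
    HasDerivAt (legendreForm a b c)
      ((1 - c) * (1 - 2 * z) * legendreForm a b c z / (z * (1 - z))) z := by
  obtain ⟨hz₀, hz₁⟩ := abs_lt_one_and_abs_one_sub_lt_one hz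
  have hu₀ := hasDerivAt_ordinaryHypergeometric (a - 1) b c hz₀
  have hu₁ := (hasDerivAt_ordinaryHypergeometric (a - 1) b c hz₁).comp_const_sub
  have hv₀ := hasDerivAt_ordinaryHypergeometric a b c hz₀
  have hv₁ := (hasDerivAt_ordinaryHypergeometric a b c hz₁).comp_const_sub
  have hu₀' := mul_deriv_ordinaryHypergeometric (a - 1) b c hz₀
  have hu₁' := mul_deriv_ordinaryHypergeometric (a - 1) b c hz₁
  rw [sub_add_cancel] at hu₀' hu₁'
  have hv₀' := mul_one_sub_mul_deriv_ordinaryHypergeometric a b hc hz₀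
  have hv₁' := mul_one_sub_mul_deriv_ordinaryHypergeometric a b hc hz₁
  refine ((((hu₀.mul hv₁).add (hu₁.mul hv₀)).const_mul (c - a)).add
    ((hv₀.mul hv₁).const_mul (a - 1))).congr_deriv ?_
  rw [eq_div_iff (mul_pos hz.1 (sub_pos.2 hz.2)).ne']
  simp only [legendreForm, hypU, hypV]
  set u₀ := ₂F₁ (a - 1) b c z
  set u₁ := ₂F₁ (a - 1) b c (1 - z)
  set v₀ := ₂F₁ a b c z
  set v₁ := ₂F₁ a b c (1 - z)
  linear_combination (c - a) * ((1 - z) * v₁ * hu₀' - z * v₀ * hu₁')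
    + ((c - a) * u₁ + (a - 1) * v₁) * hv₀' - ((c - a) * u₀ + (a - 1) * v₀) * hv₁'
    + ((c - a) * ((1 - z) * u₀ * v₁ - z * u₁ * v₀) + (a - 1) * (1 - 2 * z) * v₀ * v₁) * habc

lemma exists_rpow_mul_legendreForm_eq :
    ∃ A, ∀ z ∈ Ioo (0 : ℝ) 1, z ^ (c - 1) * (1 - z) ^ (c - 1) * legendreForm a b c z = A := by
  have hderiv (z : ℝ) (hz : z ∈ Ioo (0 : ℝ) 1) :
      HasDerivAt (fun z ↦ z ^ (c - 1) * (1 - z) ^ (c - 1) * legendreForm a b c z) 0 z := by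
    have hz₀ := hz.1.ne'
    have hz₁ := (sub_pos.2 hz.2).ne'
    refine (((Real.hasDerivAt_rpow_const (p := c - 1) (.inl hz₀)).mul
      (Real.hasDerivAt_rpow_const (p := c - 1) (.inl hz₁)).comp_const_sub).mul
        (hasDerivAt_legendreForm hc habc hz)).congr_deriv ?_
    simp only [Pi.mul_apply, Real.rpow_sub_one hz₀ (c - 1), Real.rpow_sub_one hz₁ (c - 1)]
    field_simp
    ring
  exact isOpen_Ioo.exists_is_const_of_deriv_eq_zero isPreconnected_Ioo
    (fun z hz ↦ (hderiv z hz).differentiableAt.differentiableWithinAt)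
    fun z hz ↦ (hderiv z hz).deriv

lemma legendreForm_eq_mul_legendreForm_add_one (hb : b ≠ 0) {z : ℝ} (hz : z ∈ Ioo (0 : ℝ) 1) :
    legendreForm a b c z
      = z * (1 - z) * (a * b / c ^ 2 * legendreForm (a + 1) (b + 1) (c + 1) z) := by
  obtain ⟨hz₀, hz₁⟩ := abs_lt_one_and_abs_one_sub_lt_one hz
  have h₀ := one_sub_mul_deriv_ordinaryHypergeometric a b hc hz₀
  have h₁ := one_sub_mul_deriv_ordinaryHypergeometric a b hc hz₁
  rw [legendreForm_eq_mul_deriv hc habc hz]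
  congr 1
  refine mul_left_cancel₀ hb ?_
  rw [deriv_ordinaryHypergeometric a b c hz₀] at h₀ ⊢
  rw [deriv_ordinaryHypergeometric a b c hz₁] at h₁ ⊢
  simp only [legendreForm, hypU, hypV, add_sub_cancel_right]
  linear_combination -(a * b / c * ₂F₁ (a + 1) (b + 1) (c + 1) z) * h₁
    - a * b / c * ₂F₁ (a + 1) (b + 1) (c + 1) (1 - z) * h₀

end FirstOrderSystem

section Constant

variable (ha : ∀ k : ℕ, a ≠ -k) (hb : ∀ k : ℕ, b ≠ -k) (habc : 2 * c = a + b + 1)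
include ha hb habc

lemma tendsto_rpow_mul_legendreForm (hc : 0 < c) :
    Tendsto (fun z ↦ z ^ (c - 1) * (1 - z) ^ (c - 1) * legendreForm a b c z) (𝓝[>] 0)
      (𝓝 (Real.Gamma c ^ 2 / (Real.Gamma a * Real.Gamma b))) := by
  have hsub : Tendsto (fun z : ℝ ↦ 1 - z) (𝓝[>] 0) (𝓝[<] (1 - 0)) :=
    ContinuousWithinAt.tendsto_nhdsWithin (by fun_prop) fun z hz ↦ by simpa using hz
  rw [sub_zero] at hsub
  have hv₁ := (tendsto_one_sub_rpow_mul_ordinaryHypergeometric_zero ha hb hc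
    (by linarith : a + b < c + c)).comp hsub
  have hv₁' := (tendsto_one_sub_rpow_mul_deriv_ordinaryHypergeometric ha hb hc.ne'
    (by linarith)).comp hsub
  rw [show a + b + 1 - c = c by linarith, ← sq] at hv₁'
  have hF := analyticAt_ordinaryHypergeometric a b c (norm_zero.trans_lt one_pos)
  have hv := hF.continuousAt.tendsto.mono_left (nhdsWithin_le_nhds (s := Ioi 0))
  have hv' := hF.deriv.continuousAt.tendsto.mono_left (nhdsWithin_le_nhds (s := Ioi 0))
  have hpow : Tendsto (fun z : ℝ ↦ (1 - z) ^ c) (𝓝[>] 0) (𝓝 ((1 - 0) ^ c)) :=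
    ((continuousAt_const.sub continuousAt_id).rpow_const (.inr hc.le)).tendsto.mono_left
      nhdsWithin_le_nhds
  have hlim := hpow.mul ((hv'.mul hv₁).add (hv.mul hv₁'))
  rw [ordinaryHypergeometric_zero, sub_zero, Real.one_rpow, mul_zero, zero_add, one_mul,
    one_mul] at hlim
  refine hlim.congr' ?_
  filter_upwards [Ioo_mem_nhdsGT one_pos] with z hz
  have hz₀ := hz.1.ne'
  have hz₁ := (sub_pos.2 hz.2).ne'
  rw [legendreForm_eq_mul_deriv (ne_neg_natCast_of_pos hc) habc hz, Real.rpow_sub_one hz₀,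
    Real.rpow_sub_one hz₁]
  simp only [Function.comp_apply, sub_sub_cancel]
  field_simp

lemma legendreForm_eq_of_pos (hc : 0 < c) {z : ℝ} (hz : z ∈ Ioo (0 : ℝ) 1) :
    legendreForm a b c z = Real.Gamma c ^ 2 / (Real.Gamma a * Real.Gamma b) *
      (z ^ (1 - c) * (1 - z) ^ (1 - c)) := by
  obtain ⟨A, hA⟩ := exists_rpow_mul_legendreForm_eq (ne_neg_natCast_of_pos hc) habc
  have hA' : A = Real.Gamma c ^ 2 / (Real.Gamma a * Real.Gamma b) := by
    refine tendsto_nhds_unique (tendsto_const_nhds.congr' ?_)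
      (tendsto_rpow_mul_legendreForm ha hb habc hc)
    filter_upwards [Ioo_mem_nhdsGT one_pos] with z hz using (hA z hz).symm
  have hz₀ : 0 < z ^ (c - 1) := Real.rpow_pos_of_pos hz.1 _
  have hz₁ : 0 < (1 - z) ^ (c - 1) := Real.rpow_pos_of_pos (sub_pos.2 hz.2) _
  rw [← neg_sub c 1, Real.rpow_neg hz.1.le, Real.rpow_neg (sub_pos.2 hz.2).le, ← hA', ← hA z hz]
  field_simp

lemma legendreForm_eq (hc : ∀ k : ℕ, c ≠ -k) {z : ℝ} (hz : z ∈ Ioo (0 : ℝ) 1) :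
    legendreForm a b c z = Real.Gamma c ^ 2 / (Real.Gamma a * Real.Gamma b) *
      (z ^ (1 - c) * (1 - z) ^ (1 - c)) := by
  obtain ⟨n, hn⟩ := exists_nat_gt (-c)
  induction n generalizing a b c with
  | zero => exact legendreForm_eq_of_pos ha hb habc (by simpa using hn) hz
  | succ n ih =>
    have ha₀ : a ≠ 0 := by simpa using ha 0
    have hb₀ : b ≠ 0 := by simpa using hb 0
    have hc₀ : c ≠ 0 := by simpa using hc 0
    push_cast at hn
    rw [legendreForm_eq_mul_legendreForm_add_one hc habc hb₀ hz,
      ih (add_one_ne_neg_natCast ha) (add_one_ne_neg_natCast hb) (by linarith)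
        (add_one_ne_neg_natCast hc) (by linarith),
      show 1 - c = 1 - (c + 1) + 1 by ring, Real.rpow_add_one hz.1.ne',
      Real.rpow_add_one (sub_pos.2 hz.2).ne', Real.Gamma_add_one ha₀, Real.Gamma_add_one hb₀,
      Real.Gamma_add_one hc₀]
    field_simp

end Constant

lemma legendreForm_sq_eq_genLegendre (a : ℝ) {r : ℝ} (hr : r ^ 2 ≤ 1) :
    legendreForm a (1 - a) 1 (r ^ 2) = (1 - a) * (2 / Real.pi) ^ 2 * genLegendre a r := by
  have hpi := Real.pi_ne_zero
  simp only [legendreForm, hypU, hypV, genLegendre, genEllipticK, genEllipticE,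
    Real.sq_sqrt (sub_nonneg.2 hr)]
  field_simp
  ring

lemma genLegendre_eq (ha : ∀ k : ℕ, a ≠ -k) (ha' : ∀ k : ℕ, 1 - a ≠ -k) {r : ℝ}
    (hr : r ^ 2 ∈ Ioo (0 : ℝ) 1) :
    genLegendre a r = Real.pi * Real.sin (Real.pi * a) / (4 * (1 - a)) := by
  have ha₁ : 1 - a ≠ 0 := by simpa using ha' 0
  have h := legendreForm_eq ha ha' (by ring) (ne_neg_natCast_of_pos one_pos) hr
  rw [legendreForm_sq_eq_genLegendre a hr.2.le, sub_self, Real.rpow_zero, Real.rpow_zero,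
    Real.Gamma_one, Real.Gamma_mul_Gamma_one_sub] at h
  have hpi := Real.pi_ne_zero
  field_simp at h ⊢
  linear_combination h

end LegendreForm

theorem lemma4p5_general (a b c : ℝ) (ha : ∀ k : ℕ, a ≠ -k) (hb : ∀ k : ℕ, b ≠ -k)
    (hc : ∀ k : ℕ, c ≠ -k) (habc : 2 * c = a + b + 1) :
    (∀ A : ℝ,
      (∀ z ∈ Ioo (0 : ℝ) 1, legendreForm a b c z = A * (z ^ (1 - c) * (1 - z) ^ (1 - c))) ↔
      A = Real.Gamma c ^ 2 / (Real.Gamma a * Real.Gamma b)) ∧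
    (c = 1 → ∀ r ∈ Ioo (0 : ℝ) 1,
      legendreForm a b c (r ^ 2) = (1 - a) * (2 / Real.pi) ^ 2 * genLegendre a r ∧
      genLegendre a r = Real.pi * Real.sin (Real.pi * a) / (4 * (1 - a))) := by
  refine ⟨fun A ↦ ⟨fun h ↦ ?_, ?_⟩, ?_⟩
  · obtain ⟨z, hz⟩ : (Ioo (0 : ℝ) 1).Nonempty := nonempty_Ioo.2 one_pos
    have hpos : 0 < z ^ (1 - c) * (1 - z) ^ (1 - c) :=
      mul_pos (Real.rpow_pos_of_pos hz.1 _) (Real.rpow_pos_of_pos (sub_pos.2 hz.2) _)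
    exact mul_right_cancel₀ hpos.ne' ((h z hz).symm.trans (legendreForm_eq ha hb habc hc hz))
  · rintro rfl z hz
    exact legendreForm_eq ha hb habc hc hz
  · rintro rfl r hr
    obtain rfl : b = 1 - a := by linarith
    have hr₂ : r ^ 2 ∈ Ioo (0 : ℝ) 1 := ⟨pow_pos hr.1 2, pow_lt_one₀ hr.1.le hr.2 two_ne_zero⟩
    exact ⟨legendreForm_sq_eq_genLegendre a hr₂.2.le, genLegendre_eq ha hb hr₂⟩

theorem lemma4p5 (a b c : ℝ) (ha : 0 < a) (hb : 0 < b) (hc : 1 ≤ c) (habc : 2 * c = a + b + 1) :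
    -- a constant `A` satisfies the identity on `(0,1)` if and only if it has the stated value
    (∀ A : ℝ,
      (∀ z ∈ Set.Ioo (0 : ℝ) 1,
        legendreForm a b c z = A * (z ^ (1 - c) * (1 - z) ^ (1 - c))) ↔
      A = Real.Gamma c ^ 2 / (Real.Gamma a * Real.Gamma b)) ∧
    -- for `c = 1` the left side at `z = r²` is a multiple of that of Legendre's relation,
    -- and Legendre's relation for generalized elliptic integrals holds
    (c = 1 → ∀ r ∈ Set.Ioo (0 : ℝ) 1,
      legendreForm a b c (r ^ 2) = (1 - a) * (2 / Real.pi) ^ 2 * genLegendre a r ∧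
      genLegendre a r = Real.pi * Real.sin (Real.pi * a) / (4 * (1 - a))) :=
  lemma4p5_general a b c (ne_neg_natCast_of_pos ha) (ne_neg_natCast_of_pos hb)
    (ne_neg_natCast_of_pos (one_pos.trans_le hc)) habc
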